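/- Let $r>0$. A subset of the Euclidean plane is called $r$-maximal if it is maximal, with respect to inclusion, among the subsets of the plane of diameter at most $r$. Let $I\subseteq\mathbb R$ be a nondegenerate interval and $\gamma:I\to\mathbb R^2$ a regular curve having a curvature at every point, i.e. $\gamma$ is differentiable with $\gamma'\neq 0$ and its unit tangent $T=\gamma'/|\gamma'|$ is differentiable. Suppose that its radius of curvature $|\gamma'(t)|/|T'(t)|$ (read as $\infty$ where $T'(t)=0$) is at most $r$ for every $t\in I$. Then any sufficiently short piece of the curve can be embedded in the boundary of an $r$-maximal set, and pieces along which the normal turns by at most $\pi/3$ are sufficiently short. Precisely: (1) For every compact interval $[a,b]\subseteq I$ there is $\delta>0$ such that, for every interval $J\subseteq[a,b]$ for which $\gamma|_J$ has arc length at most $\delta$, $\gamma|_J$ is injective and $\gamma(J)$ is contained in the boundary of some $r$-maximal subset of the plane. (2) Let $J\subseteq I$ be an interval and let $\theta:J\to\mathbb R$ be a continuous determination of the angle of the unit normal along $\gamma|_J$, i.e. $(\cos\theta(t),\sin\theta(t))\perp\gamma'(t)$ for all $t\in J$. If $|\theta(s)-\theta(t)|\le\pi/3$ for all $s,t\in J$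 (for instance, if $\gamma$ is parametrized by the angle of its unit normal and $J$ has length at most $\pi/3$), then $\gamma|_J$ is injective and $\gamma(J)$ is contained in the boundary of some $r$-maximal subset of the plane. -/

import Mathlib

open Set
open scoped ENNReal

noncomputable section

/-- The Euclidean plane. -/
abbrev Plane : Type := EuclideanSpace ℝ (Fin 2)

/-- A subset of a metric space is `r`-bounded when its diameter is at most `r`. -/
def IsRBounded {X : Type*} [MetricSpace X] (r : ℝ) (C : Set X) : Prop :=
  Metric.ediam C ≤ ENNReal.ofReal r

/-- A subset of a metric space is `r`-maximal when it is maximal (for inclusion) among the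
`r`-bounded subsets. -/
def IsRMaximal {X : Type*} [MetricSpace X] (r : ℝ) (C : Set X) : Prop :=
  Maximal (IsRBounded r) C

/-- The unit tangent vector at parameter `t` of a plane curve `γ` defined on `I`
(derivatives at end points that belong to `I` are one-sided). -/
def unitTangent (γ : ℝ → Plane) (I : Set ℝ) (t : ℝ) : Plane :=
  ‖derivWithin γ I t‖⁻¹ • derivWithin γ I t

/-- A regular plane curve on a nondegenerate interval `I` that has a curvature at every point:
`γ` is differentiable with nonvanishing velocity and its unit tangent vector is differentiable.
This includes every regular twice differentiable curve, and every differentiable curve with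
nonvanishing velocity that is parametrized by the angle of its unit normal. -/
structure IsRegularCurve (γ : ℝ → Plane) (I : Set ℝ) : Prop where
  ordConnected : I.OrdConnected
  nontrivial : I.Nontrivial
  differentiableOn : DifferentiableOn ℝ γ I
  velocity_ne_zero : ∀ t ∈ I, derivWithin γ I t ≠ 0
  differentiableOn_unitTangent : DifferentiableOn ℝ (unitTangent γ I) I

/-- The (unsigned) curvature `|dT/ds|`, where `T` is the unit tangent vector and `s` the
arc length, so that `ds/dt` is the speed. -/
def curvature (γ : ℝ → Plane) (I : Set ℝ) (t : ℝ) : ℝ :=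
  ‖derivWithin (unitTangent γ I) I t‖ / ‖derivWithin γ I t‖

/-- The radius of curvature, the reciprocal of the curvature; it is `∞` where the curvature
vanishes. -/
def radiusOfCurvature (γ : ℝ → Plane) (I : Set ℝ) (t : ℝ) : ℝ≥0∞ :=
  (ENNReal.ofReal (curvature γ I t))⁻¹

/-- `θ` is a continuous determination, on the piece `J` of the curve, of the angle of a unit
normal: the unit vector `(cos θ, sin θ)` is perpendicular to the velocity. -/
def IsNormalAngle (γ : ℝ → Plane) (I J : Set ℝ) (θ : ℝ → ℝ) : Prop :=
  ContinuousOn θ J ∧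
    ∀ t ∈ J, inner ℝ (!₂[Real.cos (θ t), Real.sin (θ t)] : Plane) (derivWithin γ I t) = 0

/-- The piece of the curve `γ` with parameters in `J` is embedded in the boundary of some
`r`-maximal subset of the plane. -/
def EmbedsInRMaximalBoundary (r : ℝ) (γ : ℝ → Plane) (J : Set ℝ) : Prop :=
  InjOn γ J ∧ ∃ C : Set Plane, IsRMaximal r C ∧ γ '' J ⊆ frontier C

end

open Real Filter Topology

/-! ### Planar arcs described by their tangent angle -/

/-! Pair each point `γ t` with its opposite `g t`, at distance `r` along the inner normal. If `γ ''
J ∪ g '' J` has diameter at most `r`, Zorn's lemma puts it in an `r`-maximal set, and each `γ t` is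
on the boundary because `g t` is at distance exactly `r`.

For the diameter, let `φ` be the tangent angle. The curvature bound says that the speed is at most
`r` times the rate of `φ`, so `-g` is an arc of the same kind, with complementary speed. Comparison
with a circle of radius `r` shows that an arc turning by at most `π / 3` has chords at most `2 r sin
(π / 6) = r` (`IsArc.chord_sq_le`, applied to both curves) and stays in the tangent discs of radius
`r` (`IsArc.dist_opposite_sq_le`).

The tangent angle comes from the given normal angle, or, on short pieces, from uniform continuity of
the unit tangent. -/

theorem le_of_hasDerivWithinAt_nonneg {J : Set ℝ} (hJ : J.OrdConnected) {f f' : ℝ → ℝ}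
    (hf : ∀ u ∈ J, HasDerivWithinAt f (f' u) J u) {s t : ℝ} (hs : s ∈ J) (ht : t ∈ J)
    (hst : s ≤ t) (h0 : ∀ u ∈ Icc s t, 0 ≤ f' u) : f s ≤ f t := by
  have hsub : Icc s t ⊆ J := hJ.out hs ht
  refine monotoneOn_of_hasDerivWithinAt_nonneg (f' := f') (convex_Icc s t)
    (fun u hu => ((hf u (hsub hu)).continuousWithinAt).mono hsub)
    (fun u hu => (hf u (hsub (interior_subset hu))).mono (interior_subset.trans hsub))
    (fun u hu => h0 u (interior_subset hu)) (left_mem_Icc.2 hst) (right_mem_Icc.2 hst) hst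

theorem lt_of_hasDerivWithinAt_pos {J : Set ℝ} (hJ : J.OrdConnected) {f f' : ℝ → ℝ}
    (hf : ∀ u ∈ J, HasDerivWithinAt f (f' u) J u) {s t : ℝ} (hs : s ∈ J) (ht : t ∈ J)
    (hst : s < t) (h0 : ∀ u ∈ Icc s t, 0 < f' u) : f s < f t := by
  have hsub : Icc s t ⊆ J := hJ.out hs ht
  refine strictMonoOn_of_hasDerivWithinAt_pos (f' := f') (convex_Icc s t)
    (fun u hu => ((hf u (hsub hu)).continuousWithinAt).mono hsub)
    (fun u hu => (hf u (hsub (interior_subset hu))).mono (interior_subset.trans hsub))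
    (fun u hu => h0 u (interior_subset hu)) (left_mem_Icc.2 hst.le) (right_mem_Icc.2 hst.le) hst

/-- The curve `(x, y)` on the interval `J` has velocity `p (cos φ, sin φ)`, where the angle `φ`
is nondecreasing with derivative `k` and `0 ≤ p ≤ r k`. -/
structure IsArc (r : ℝ) (J : Set ℝ) (x y φ p k : ℝ → ℝ) : Prop where
  ordConnected : J.OrdConnected
  deriv_x : ∀ t ∈ J, HasDerivWithinAt x (p t * cos (φ t)) J t
  deriv_y : ∀ t ∈ J, HasDerivWithinAt y (p t * sin (φ t)) J t
  deriv_angle : ∀ t ∈ J, HasDerivWithinAt φ (k t) J t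
  speed_nonneg : ∀ t ∈ J, 0 ≤ p t
  rate_nonneg : ∀ t ∈ J, 0 ≤ k t
  speed_le : ∀ t ∈ J, p t ≤ r * k t

namespace IsArc

variable {r : ℝ} {J : Set ℝ} {x y φ p k : ℝ → ℝ}

theorem angle_le (h : IsArc r J x y φ p k) {s t : ℝ} (hs : s ∈ J) (ht : t ∈ J) (hst : s ≤ t) :
    φ s ≤ φ t :=
  le_of_hasDerivWithinAt_nonneg h.ordConnected h.deriv_angle hs ht hst
    fun u hu => h.rate_nonneg u (h.ordConnected.out hs ht hu)

theorem hasDerivWithinAt_proj (h : IsArc r J x y φ p k) (β : ℝ) {t : ℝ} (ht : t ∈ J) :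
    HasDerivWithinAt (fun u => x u * cos β + y u * sin β) (p t * cos (φ t - β)) J t := by
  refine HasDerivWithinAt.congr_deriv
    (((h.deriv_x t ht).mul_const (cos β)).add
      ((h.deriv_y t ht).mul_const (sin β))) ?_
  rw [cos_sub]; ring

theorem proj_nonneg (h : IsArc r J x y φ p k) {s t β : ℝ} (hs : s ∈ J) (ht : t ∈ J)
    (hst : s ≤ t) (h₁ : β - π / 2 ≤ φ s) (h₂ : φ t ≤ β + π / 2) :
    0 ≤ (x t - x s) * cos β + (y t - y s) * sin β := by
  have hsub := h.ordConnected.out hs ht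
  have := le_of_hasDerivWithinAt_nonneg h.ordConnected
    (fun u hu => h.hasDerivWithinAt_proj β hu) hs ht hst fun u hu =>
      mul_nonneg (h.speed_nonneg u (hsub hu)) <| cos_nonneg_of_neg_pi_div_two_le_of_le
        (by linarith [h.angle_le hs (hsub hu) hu.1]) (by linarith [h.angle_le (hsub hu) ht hu.2])
  linarith

theorem proj_pos (h : IsArc r J x y φ p k) (hp : ∀ t ∈ J, 0 < p t) {s t β : ℝ} (hs : s ∈ J)
    (ht : t ∈ J) (hst : s < t) (h₁ : β - π / 2 < φ s) (h₂ : φ t < β + π / 2) :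
    0 < (x t - x s) * cos β + (y t - y s) * sin β := by
  have hsub := h.ordConnected.out hs ht
  have := lt_of_hasDerivWithinAt_pos h.ordConnected
    (fun u hu => h.hasDerivWithinAt_proj β hu) hs ht hst fun u hu =>
      mul_pos (hp u (hsub hu)) <| cos_pos_of_mem_Ioo
        ⟨by linarith [h.angle_le hs (hsub hu) hu.1], by linarith [h.angle_le (hsub hu) ht hu.2]⟩
  linarith

/-- The opposite curve at distance `r` along the inner normal, reflected in the origin. -/
theorem opposite (h : IsArc r J x y φ p k) :
    IsArc r J (fun t => r * sin (φ t) - x t) (fun t => -(r * cos (φ t)) - y t) φ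
      (fun t => r * k t - p t) k where
  ordConnected := h.ordConnected
  deriv_x t ht := by
    refine HasDerivWithinAt.congr_deriv
      ((((h.deriv_angle t ht).sin).const_mul r).sub (h.deriv_x t ht)) ?_
    ring
  deriv_y t ht := by
    refine HasDerivWithinAt.congr_deriv
      ((((h.deriv_angle t ht).cos).const_mul r).neg.sub (h.deriv_y t ht)) ?_
    ring
  deriv_angle := h.deriv_angle
  -- The bounds `0 ≤ p` and `p ≤ r * k` exchange roles under `p ↦ r * k - p`.
  speed_nonneg t ht := by linarith [h.speed_le t ht]
  rate_nonneg := h.rate_nonneg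
  speed_le t ht := by linarith [h.speed_nonneg t ht]

/-- Comparison with the circle of radius `r`: the right side is the projected chord of a circular
arc with the same tangent angles, and the difference is the projection of the opposite arc. -/
theorem proj_le (h : IsArc r J x y φ p k) {s t β : ℝ} (hs : s ∈ J) (ht : t ∈ J)
    (hst : s ≤ t) (h₁ : β - π / 2 ≤ φ s) (h₂ : φ t ≤ β + π / 2) :
    (x t - x s) * cos β + (y t - y s) * sin β ≤ r * (sin (φ t - β) - sin (φ s - β)) := by
  have := h.opposite.proj_nonneg hs ht hst h₁ h₂
  rw [sin_sub, sin_sub]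
  linarith

/-- An arc that turns by at most `π / 3` has chords of length at most `r`. -/
theorem chord_sq_le (h : IsArc r J x y φ p k) (hr : 0 ≤ r) {s t : ℝ} (hs : s ∈ J) (ht : t ∈ J)
    (hst : s ≤ t) (hφ : φ t - φ s ≤ π / 3) :
    (x t - x s) ^ 2 + (y t - y s) ^ 2 ≤ r ^ 2 := by
  have hle := h.angle_le hs ht hst
  have hpi := pi_pos
  -- The chord is parallel to an intermediate tangent direction: its normal component is nonnegative
  -- for `β = φ s` and nonpositive for `β = φ t`.
  obtain ⟨β, hβ, h0⟩ : ∃ β ∈ Icc (φ s) (φ t),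
      (x t - x s) * (-sin β) + (y t - y s) * cos β = 0 := by
    have h₁ := h.proj_nonneg (β := φ s + π / 2) hs ht hst (by linarith) (by linarith)
    have h₂ := h.proj_nonneg (β := φ t - π / 2) hs ht hst (by linarith) (by linarith)
    rw [cos_add_pi_div_two, sin_add_pi_div_two] at h₁
    rw [cos_sub_pi_div_two, sin_sub_pi_div_two] at h₂
    exact intermediate_value_Icc' hle (f := fun β => (x t - x s) * (-sin β) + (y t - y s) * cos β)
      (by fun_prop) ⟨by linarith, h₁⟩
  have hlow := h.proj_nonneg (β := β) hs ht hst (by linarith [hβ.2]) (by linarith [hβ.1])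
  have hup := h.proj_le (β := β) hs ht hst (by linarith [hβ.2]) (by linarith [hβ.1])
  -- The difference is at most twice the sine of half the turn, hence at most `2 sin (π / 6)`.
  have hsin : sin (φ t - β) - sin (φ s - β) ≤ 1 := by
    rw [sin_sub_sin]
    have e₁ : sin ((φ t - β - (φ s - β)) / 2) ≤ 1 / 2 := by
      rw [← sin_pi_div_six]
      exact sin_le_sin_of_le_of_le_pi_div_two (by linarith) (by linarith) (by linarith)
    have e₂ : 0 ≤ sin ((φ t - β - (φ s - β)) / 2) :=
      sin_nonneg_of_nonneg_of_le_pi (by linarith) (by linarith)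
    nlinarith [cos_le_one ((φ t - β + (φ s - β)) / 2)]
  have hle : (x t - x s) * cos β + (y t - y s) * sin β ≤ r := by nlinarith
  have key : (x t - x s) ^ 2 + (y t - y s) ^ 2
      = ((x t - x s) * cos β + (y t - y s) * sin β) ^ 2
        + ((x t - x s) * (-sin β) + (y t - y s) * cos β) ^ 2 := by
    linear_combination (-((x t - x s) ^ 2 + (y t - y s) ^ 2)) * (sin_sq_add_cos_sq β)
  rw [key, h0]
  nlinarith

/-- The arc stays in the disc of radius `r` internally tangent to it at any of its points. -/
theorem dist_opposite_sq_le (h : IsArc r J x y φ p k) {s t : ℝ} (hs : s ∈ J)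
    (ht : t ∈ J) (hφ : |φ t - φ s| ≤ π / 2) :
    (x t - (x s - r * sin (φ s))) ^ 2 + (y t - (y s + r * cos (φ s))) ^ 2 ≤ r ^ 2 := by
  rw [abs_le] at hφ
  have hpi := pi_pos
  -- The squared distance to the centre of the tangent disc at `s` is maximal at `s`: by `proj_le`
  -- with `β = φ u`, its derivative is nonnegative before `s` and nonpositive after.
  set f : ℝ → ℝ := fun u =>
    (x u - (x s - r * sin (φ s))) ^ 2 + (y u - (y s + r * cos (φ s))) ^ 2 with hf
  set f' : ℝ → ℝ := fun u => 2 * (p u * ((x u - x s) * cos (φ u) + (y u - y s) * sin (φ u)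
      - r * sin (φ u - φ s))) with hf'
  have hd : ∀ u ∈ J, HasDerivWithinAt f (f' u) J u := fun u hu => by
    refine HasDerivWithinAt.congr_deriv
      ((((h.deriv_x u hu).sub_const (x s - r * sin (φ s))).pow 2).add
      (((h.deriv_y u hu).sub_const (y s + r * cos (φ s))).pow 2)) ?_
    simp only [hf', sin_sub]; ring
  have hfs : f s = r ^ 2 := by
    simp only [hf]
    linear_combination r ^ 2 * (sin_sq_add_cos_sq (φ s))
  change f t ≤ r ^ 2
  rw [← hfs]
  rcases le_total s t with hst | hst
  · have := le_of_hasDerivWithinAt_nonneg h.ordConnected (fun u hu => (hd u hu).neg) hs ht hst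
      fun u hu => by
        have huJ := h.ordConnected.out hs ht hu
        have h1 := h.angle_le hs huJ hu.1
        have h2 := h.angle_le huJ ht hu.2
        have h3 := h.proj_le (β := φ u) hs huJ hu.1 (by linarith) (by linarith)
        have h4 := h.speed_nonneg u huJ
        rw [sub_self, sin_zero, zero_sub, ← sin_neg, neg_sub] at h3
        simp only [hf']
        nlinarith
    exact neg_le_neg_iff.1 this
  · refine le_of_hasDerivWithinAt_nonneg h.ordConnected hd ht hs hst fun u hu => ?_
    have huJ := h.ordConnected.out ht hs hu
    have h1 := h.angle_le ht huJ hu.1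
    have h2 := h.angle_le huJ hs hu.2
    have h3 := h.proj_le (β := φ u) huJ hs hu.2 (by linarith) (by linarith)
    have h4 := h.speed_nonneg u huJ
    rw [sub_self, sin_zero, sub_zero, ← neg_sub (φ u) (φ s), sin_neg] at h3
    simp only [hf']
    nlinarith

end IsArc

/-! ### Maximal sets -/

/-- Zorn's lemma applies since two points in the union of a chain lie in a common member. -/
theorem IsRBounded.exists_isRMaximal {X : Type*} [MetricSpace X] {r : ℝ} {A : Set X}
    (hA : IsRBounded r A) : ∃ C, A ⊆ C ∧ IsRMaximal r C := by
  refine zorn_subset_nonempty {C : Set X | IsRBounded r C} (fun c hc hchain _ => ?_) A hA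
  refine ⟨⋃₀ c, ?_, fun s hs => subset_sUnion_of_mem hs⟩
  refine Metric.ediam_le fun a ha b hb => ?_
  obtain ⟨s, hs, has⟩ := ha
  obtain ⟨t, ht, hbt⟩ := hb
  rcases hchain.total hs ht with h | h
  · exact (Metric.edist_le_ediam_of_mem (h has) hbt).trans (hc ht)
  · exact (Metric.edist_le_ediam_of_mem has (h hbt)).trans (hc hs)

/-- A point of an `r`-bounded set at distance `r` from another point of the set lies on the
boundary. -/
theorem IsRBounded.mem_frontier {E : Type*} [NormedAddCommGroup E] [NormedSpace ℝ E] {r : ℝ}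
    (hr : 0 < r) {C : Set E} (hC : IsRBounded r C) {a b : E} (ha : a ∈ C) (hb : b ∈ C)
    (hab : dist a b = r) : a ∈ frontier C := by
  rw [frontier_eq_closure_inter_closure]
  refine ⟨subset_closure ha, ?_⟩
  -- Pushing `a` away from `b` gives points at distance `(1 + ε) * r` from `b`, hence outside `C`.
  have hlim : Tendsto (fun ε : ℝ => a + ε • (a - b)) (𝓝[>] 0) (𝓝 a) := by
    have : Continuous fun ε : ℝ => a + ε • (a - b) := by fun_prop
    simpa using (this.tendsto 0).mono_left nhdsWithin_le_nhds
  refine mem_closure_of_tendsto hlim ?_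
  filter_upwards [self_mem_nhdsWithin] with ε hε hmem
  have h := (Metric.edist_le_ediam_of_mem hmem hb).trans hC
  rw [edist_dist, ENNReal.ofReal_le_ofReal_iff hr.le, dist_eq_norm] at h
  have e : a + ε • (a - b) - b = (1 + ε) • (a - b) := by module
  have hε' : 0 < ε := hε
  rw [e, norm_smul, ← dist_eq_norm, hab, Real.norm_of_nonneg (by linarith)] at h
  nlinarith

theorem Plane.dist_le_iff {r : ℝ} (hr : 0 ≤ r) (a b : Plane) :
    dist a b ≤ r ↔ (a 0 - b 0) ^ 2 + (a 1 - b 1) ^ 2 ≤ r ^ 2 := by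
  rw [EuclideanSpace.dist_eq, Fin.sum_univ_two, Real.sqrt_le_left hr, Real.dist_eq, Real.dist_eq,
    sq_abs, sq_abs]

theorem IsArc.embedsInRMaximalBoundary {r : ℝ} (hr : 0 < r) {J : Set ℝ} {γ : ℝ → Plane}
    {φ p k : ℝ → ℝ} (h : IsArc r J (fun t => γ t 0) (fun t => γ t 1) φ p k)
    (hp : ∀ t ∈ J, 0 < p t) (hφ : ∀ s ∈ J, ∀ t ∈ J, |φ s - φ t| ≤ π / 3) :
    EmbedsInRMaximalBoundary r γ J := by
  have hpi := pi_pos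
  refine ⟨fun s hs t ht hst => ?_, ?_⟩
  · by_contra hne
    wlog hlt : s < t generalizing s t
    · exact this t ht s hs hst.symm (Ne.symm hne) (lt_of_le_of_ne (not_lt.1 hlt) (Ne.symm hne))
    -- Injectivity: the projection onto the tangent at `s` strictly increases.
    have := h.proj_pos hp (β := φ s) hs ht hlt (by linarith)
      (by linarith [(abs_le.1 (hφ t ht s hs)).2])
    rw [hst] at this
    simp at this
  · set g : ℝ → Plane := fun t =>
      !₂[γ t 0 - r * sin (φ t), γ t 1 + r * cos (φ t)] with hg
    have hcc : ∀ s ∈ J, ∀ t ∈ J, dist (γ s) (γ t) ≤ r := fun s hs t ht => by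
      wlog hst : s ≤ t generalizing s t
      · rw [dist_comm]; exact this t ht s hs (le_of_not_ge hst)
      rw [dist_comm, Plane.dist_le_iff hr.le]
      exact h.chord_sq_le hr.le hs ht hst (abs_le.1 (hφ t ht s hs)).2
    have hgg : ∀ s ∈ J, ∀ t ∈ J, dist (g s) (g t) ≤ r := fun s hs t ht => by
      wlog hst : s ≤ t generalizing s t
      · rw [dist_comm]; exact this t ht s hs (le_of_not_ge hst)
      rw [Plane.dist_le_iff hr.le]
      -- `g` is minus the opposite arc, so it has the same chord lengths.
      refine le_trans (le_of_eq ?_)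
        (h.opposite.chord_sq_le hr.le hs ht hst (abs_le.1 (hφ t ht s hs)).2)
      simp [hg]; ring
    have hcg : ∀ s ∈ J, ∀ t ∈ J, dist (γ s) (g t) ≤ r := fun s hs t ht => by
      rw [Plane.dist_le_iff hr.le]
      simpa [hg] using h.dist_opposite_sq_le ht hs (by linarith [hφ s hs t ht])
    have hb : IsRBounded r (γ '' J ∪ g '' J) := by
      refine Metric.ediam_le fun a ha b hb => ?_
      rw [edist_dist]
      refine ENNReal.ofReal_le_ofReal ?_
      rcases ha with ⟨s, hs, rfl⟩ | ⟨s, hs, rfl⟩ <;> rcases hb with ⟨t, ht, rfl⟩ | ⟨t, ht, rfl⟩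
      · exact hcc s hs t ht
      · exact hcg s hs t ht
      · rw [dist_comm]; exact hcg t ht s hs
      · exact hgg s hs t ht
    obtain ⟨C, hAC, hC⟩ := hb.exists_isRMaximal
    refine ⟨C, hC, ?_⟩
    rintro _ ⟨t, ht, rfl⟩
    refine IsRBounded.mem_frontier hr hC.prop (hAC (Or.inl ⟨t, ht, rfl⟩))
      (hAC (Or.inr ⟨t, ht, rfl⟩)) ?_
    rw [EuclideanSpace.dist_eq, Fin.sum_univ_two, Real.dist_eq, Real.dist_eq, sq_abs, sq_abs,
      Real.sqrt_eq_iff_mul_self_eq_of_pos hr]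
    simp [hg]
    linear_combination (-r ^ 2) * (sin_sq_add_cos_sq (φ t))

/-! ### Tangent angle of a regular curve -/

theorem Plane.hasDerivWithinAt_apply {f : ℝ → Plane} {f' : Plane} {s : Set ℝ} {t : ℝ}
    (h : HasDerivWithinAt f f' s t) (i : Fin 2) :
    HasDerivWithinAt (fun u => f u i) (f' i) s t :=
  (EuclideanSpace.proj i : Plane →L[ℝ] ℝ).hasFDerivAt.comp_hasDerivWithinAt t h

theorem Plane.norm_sq (a : Plane) : ‖a‖ ^ 2 = a 0 ^ 2 + a 1 ^ 2 := by
  rw [EuclideanSpace.norm_sq_eq, Fin.sum_univ_two, Real.norm_eq_abs, Real.norm_eq_abs, sq_abs,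
    sq_abs]

/-- A continuous determination of the angle of a differentiable unit vector is differentiable. -/
theorem hasDerivWithinAt_angle {J : Set ℝ} {φ x y : ℝ → ℝ} {x' y' t : ℝ}
    (hφ : ContinuousWithinAt φ J t) (ht : t ∈ J) (hx : HasDerivWithinAt x x' J t)
    (hy : HasDerivWithinAt y y' J t) (hxφ : ∀ u ∈ J, x u = cos (φ u))
    (hyφ : ∀ u ∈ J, y u = sin (φ u)) :
    HasDerivWithinAt φ (x t * y' - y t * x') J t := by
  -- This cross product is `sin (φ u - φ t)`, so near `t` the angle `φ` is `φ t` plus its `arcsin`.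
  have hcross : HasDerivWithinAt (fun u => x t * y u - y t * x u) (x t * y' - y t * x') J t :=
    (hy.const_mul _).sub (hx.const_mul _)
  have h0 : x t * y t - y t * x t = 0 := by ring
  have harc : HasDerivAt arcsin 1 (x t * y t - y t * x t) := by
    rw [h0]
    simpa using hasDerivAt_arcsin (x := 0) (by norm_num) (by norm_num)
  have hcomp := (harc.comp_hasDerivWithinAt t hcross).const_add (φ t)
  rw [one_mul] at hcomp
  have hnear : ∀ᶠ u in 𝓝[J] t, |φ u - φ t| < π / 2 := by
    have := Metric.tendsto_nhds.1 hφ (π / 2) (by positivity)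
    simpa only [Real.dist_eq] using this
  refine hcomp.congr_of_eventuallyEq ?_ ?_
  · filter_upwards [hnear, self_mem_nhdsWithin] with u hu huJ
    rw [abs_lt] at hu
    have : x t * y u - y t * x u = sin (φ u - φ t) := by
      rw [hxφ t ht, hyφ t ht, hxφ u huJ, hyφ u huJ, sin_sub]; ring
    simp only [Function.comp_apply]
    rw [this, arcsin_sin hu.1.le hu.2.le]
    ring
  · simp [h0]

namespace IsRegularCurve

variable {γ : ℝ → Plane} {I J : Set ℝ}

theorem speed_pos (hγ : IsRegularCurve γ I) {t : ℝ} (ht : t ∈ I) : 0 < ‖derivWithin γ I t‖ :=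
  norm_pos_iff.2 (hγ.velocity_ne_zero t ht)

theorem norm_unitTangent (hγ : IsRegularCurve γ I) {t : ℝ} (ht : t ∈ I) :
    ‖unitTangent γ I t‖ = 1 := by
  rw [unitTangent, norm_smul, norm_inv, norm_norm, inv_mul_cancel₀ (hγ.speed_pos ht).ne']

theorem unitTangent_sq (hγ : IsRegularCurve γ I) {t : ℝ} (ht : t ∈ I) :
    unitTangent γ I t 0 ^ 2 + unitTangent γ I t 1 ^ 2 = 1 := by
  rw [← Plane.norm_sq, hγ.norm_unitTangent ht, one_pow]

theorem velocity_eq (hγ : IsRegularCurve γ I) {t : ℝ} (ht : t ∈ I) (i : Fin 2) :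
    derivWithin γ I t i = ‖derivWithin γ I t‖ * unitTangent γ I t i := by
  rw [unitTangent, PiLp.smul_apply, smul_eq_mul, mul_inv_cancel_left₀ (hγ.speed_pos ht).ne']

theorem uniqueDiffOn (hγ : IsRegularCurve γ I) : UniqueDiffOn ℝ I :=
  uniqueDiffOn_convex hγ.ordConnected.convex
    (hγ.ordConnected.convex.nontrivial_iff_nonempty_interior.1 hγ.nontrivial)

theorem hasDerivWithinAt_unitTangent (hγ : IsRegularCurve γ I) {t : ℝ} (ht : t ∈ I) (i : Fin 2) :
    HasDerivWithinAt (fun u => unitTangent γ I u i) (derivWithin (unitTangent γ I) I t i) I t :=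
  Plane.hasDerivWithinAt_apply (hγ.differentiableOn_unitTangent t ht).hasDerivWithinAt i

theorem unitTangent_mul_deriv (hγ : IsRegularCurve γ I) {t : ℝ} (ht : t ∈ I) :
    unitTangent γ I t 0 * derivWithin (unitTangent γ I) I t 0
      + unitTangent γ I t 1 * derivWithin (unitTangent γ I) I t 1 = 0 := by
  have h := ((hγ.hasDerivWithinAt_unitTangent ht 0).pow 2).add
    ((hγ.hasDerivWithinAt_unitTangent ht 1).pow 2)
  have hc := (hasDerivWithinAt_const t I (1 : ℝ)).congr
    (f₁ := fun u => unitTangent γ I u 0 ^ 2 + unitTangent γ I u 1 ^ 2)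
    (fun u hu => hγ.unitTangent_sq hu) (hγ.unitTangent_sq ht)
  have := (hγ.uniqueDiffOn t ht).eq_deriv _ h hc
  simp at this
  linarith

/-- The cross product is the rate of the tangent angle. As the unit tangent is orthogonal to its
derivative, its absolute value is the norm of that derivative. -/
theorem speed_le (hγ : IsRegularCurve γ I) {r : ℝ} (hr : 0 < r) {t : ℝ} (ht : t ∈ I)
    (hc : radiusOfCurvature γ I t ≤ ENNReal.ofReal r) :
    ‖derivWithin γ I t‖ ≤ r * |unitTangent γ I t 0 * derivWithin (unitTangent γ I) I t 1
      - unitTangent γ I t 1 * derivWithin (unitTangent γ I) I t 0| := by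
  have hv := hγ.speed_pos ht
  have habs : |unitTangent γ I t 0 * derivWithin (unitTangent γ I) I t 1
      - unitTangent γ I t 1 * derivWithin (unitTangent γ I) I t 0|
      = ‖derivWithin (unitTangent γ I) I t‖ := by
    rw [← abs_of_nonneg (norm_nonneg (derivWithin (unitTangent γ I) I t)),
      ← sq_eq_sq_iff_abs_eq_abs, Plane.norm_sq]
    have h1 := hγ.unitTangent_sq ht
    have h2 := hγ.unitTangent_mul_deriv ht
    generalize derivWithin (unitTangent γ I) I t 0 = a at *
    generalize derivWithin (unitTangent γ I) I t 1 = b at *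
    linear_combination (a ^ 2 + b ^ 2) * h1
      - (unitTangent γ I t 0 * a + unitTangent γ I t 1 * b) * h2
  rw [habs]
  rw [radiusOfCurvature, ENNReal.inv_le_iff_inv_le, ← ENNReal.ofReal_inv_of_pos hr] at hc
  have hc' := (ENNReal.ofReal_le_ofReal_iff
    (div_nonneg (norm_nonneg (derivWithin (unitTangent γ I) I t)) hv.le)).1 hc
  rw [le_div_iff₀ hv, inv_mul_le_iff₀ hr] at hc'
  exact hc'

/-- A piece of a curve with curvature at least `1 / r`, along which the tangent angle varies by
at most `π / 3`. -/
theorem embedsInRMaximalBoundary (hγ : IsRegularCurve γ I) {r : ℝ} (hr : 0 < r)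
    (hcurv : ∀ t ∈ I, radiusOfCurvature γ I t ≤ ENNReal.ofReal r) (hJ : J.OrdConnected)
    (hJI : J ⊆ I) {φ : ℝ → ℝ} (hφ : ContinuousOn φ J)
    (h0 : ∀ t ∈ J, unitTangent γ I t 0 = cos (φ t))
    (h1 : ∀ t ∈ J, unitTangent γ I t 1 = sin (φ t))
    (hturn : ∀ s ∈ J, ∀ t ∈ J, |φ s - φ t| ≤ π / 3) : EmbedsInRMaximalBoundary r γ J := by
  set k : ℝ → ℝ := fun t => unitTangent γ I t 0 * derivWithin (unitTangent γ I) I t 1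
      - unitTangent γ I t 1 * derivWithin (unitTangent γ I) I t 0 with hk
  have hdφ : ∀ t ∈ J, HasDerivWithinAt φ (k t) J t := fun t ht =>
    hasDerivWithinAt_angle (hφ t ht) ht ((hγ.hasDerivWithinAt_unitTangent (hJI ht) 0).mono hJI)
      ((hγ.hasDerivWithinAt_unitTangent (hJI ht) 1).mono hJI) h0 h1
  have hdγ : ∀ t ∈ J, ∀ i, HasDerivWithinAt (fun u => γ u i)
      (‖derivWithin γ I t‖ * unitTangent γ I t i) J t := fun t ht i => by
    rw [← hγ.velocity_eq (hJI ht)]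
    exact (Plane.hasDerivWithinAt_apply
      (hγ.differentiableOn t (hJI ht)).hasDerivWithinAt i).mono hJI
  have hle : ∀ t ∈ J, ‖derivWithin γ I t‖ ≤ r * |k t| := fun t ht =>
    hγ.speed_le hr (hJI ht) (hcurv t (hJI ht))
  have hk0 : ∀ t ∈ J, k t ≠ 0 := fun t ht h => by
    have := hle t ht
    rw [h, abs_zero, mul_zero] at this
    exact absurd (hγ.speed_pos (hJI ht)) (not_lt.2 this)
  -- `k` need not be continuous, but as a derivative it has the Darboux property, so it keeps one
  -- sign. If it is negative, reversing the curve turns the tangent by `π` and makes the rate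
  -- positive.
  rcases hasDerivWithinAt_forall_lt_or_forall_gt_of_forall_ne hJ.convex hdφ hk0 with hneg | hpos
  · have hmaps : MapsTo (fun t : ℝ => -t) (-J) J := fun t ht => ht
    have hconn : (-J).OrdConnected := ⟨fun s hs t ht u hu =>
      hJ.out (mem_neg.1 ht) (mem_neg.1 hs) ⟨neg_le_neg hu.2, neg_le_neg hu.1⟩⟩
    have harc : IsArc r (-J) (fun t => γ (-t) 0) (fun t => γ (-t) 1) (fun t => φ (-t) + π)
        (fun t => ‖derivWithin γ I (-t)‖) (fun t => -k (-t)) :=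
      { ordConnected := hconn
        deriv_x := fun t ht => by
          refine HasDerivWithinAt.congr_deriv
            ((hdγ (-t) ht 0).scomp t (hasDerivWithinAt_neg t (-J)) hmaps) ?_
          rw [h0 _ ht, cos_add_pi, smul_eq_mul]; ring
        deriv_y := fun t ht => by
          refine HasDerivWithinAt.congr_deriv
            ((hdγ (-t) ht 1).scomp t (hasDerivWithinAt_neg t (-J)) hmaps) ?_
          rw [h1 _ ht, sin_add_pi, smul_eq_mul]; ring
        deriv_angle := fun t ht => by
          refine HasDerivWithinAt.congr_deriv
            (((hdφ (-t) ht).scomp t (hasDerivWithinAt_neg t (-J)) hmaps).add_const π) ?_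
          rw [smul_eq_mul]; ring
        speed_nonneg := fun t ht => norm_nonneg _
        rate_nonneg := fun t ht => by linarith [hneg (-t) ht]
        speed_le := fun t ht => by
          rw [← abs_of_neg (hneg (-t) ht)]; exact hle (-t) ht }
    obtain ⟨hinj, C, hC, hsub⟩ := IsArc.embedsInRMaximalBoundary (γ := fun t => γ (-t)) hr harc
      (fun t ht => hγ.speed_pos (hJI ht))
      (fun s hs t ht => by rw [add_sub_add_right_eq_sub]; exact hturn (-s) hs (-t) ht)
    refine ⟨fun s hs t ht hst => ?_, C, hC, ?_⟩
    · refine neg_injective (@hinj (-s) ?_ (-t) ?_ ?_)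
      · simpa using hs
      · simpa using ht
      · simpa using hst
    · rintro _ ⟨t, ht, rfl⟩
      exact hsub ⟨-t, by simpa using ht, by simp⟩
  · refine IsArc.embedsInRMaximalBoundary hr (φ := φ) (k := k)
      (p := fun t => ‖derivWithin γ I t‖) ?_ (fun t ht => hγ.speed_pos (hJI ht)) hturn
    exact
      { ordConnected := hJ
        deriv_x := fun t ht => by rw [← h0 t ht]; exact hdγ t ht 0
        deriv_y := fun t ht => by rw [← h1 t ht]; exact hdγ t ht 1
        deriv_angle := hdφ
        speed_nonneg := fun t ht => norm_nonneg _
        rate_nonneg := fun t ht => (hpos t ht).le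
        speed_le := fun t ht => by
          have := hle t ht
          rwa [abs_of_pos (hpos t ht)] at this }

/-- A continuous normal angle yields a tangent angle by a quarter turn in a fixed direction. -/
theorem tangent_angle_of_normal_angle (hγ : IsRegularCurve γ I) (hJ : J.OrdConnected)
    (hJI : J ⊆ I) {θ : ℝ → ℝ} (hθ : IsNormalAngle γ I J θ) :
    ∃ c : ℝ, ∀ t ∈ J, unitTangent γ I t 0 = cos (θ t + c) ∧
      unitTangent γ I t 1 = sin (θ t + c) := by
  have hperp : ∀ t ∈ J,
      unitTangent γ I t 0 * cos (θ t) + unitTangent γ I t 1 * sin (θ t) = 0 := fun t ht => by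
    have h := hθ.2 t ht
    simp only [PiLp.inner_apply, Fin.sum_univ_two, RCLike.inner_apply, conj_trivial,
      hγ.velocity_eq (hJI ht)] at h
    simp at h
    refine (mul_eq_zero.1 (?_ : ‖derivWithin γ I t‖ * _ = 0)).resolve_left
      (hγ.speed_pos (hJI ht)).ne'
    linear_combination h
  have hcont : ∀ i, ContinuousOn (fun t => unitTangent γ I t i) J := fun i t ht =>
    (hγ.hasDerivWithinAt_unitTangent (hJI ht) i).continuousWithinAt.mono hJI
  -- The cross product of normal and tangent is continuous with square `1`, hence constant on the
  -- connected set `J`; its sign decides the quarter turn.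
  have hsq : EqOn ((fun t => unitTangent γ I t 1 * cos (θ t) - unitTangent γ I t 0 * sin (θ t)) ^ 2)
      ((fun _ => (1 : ℝ)) ^ 2) J := fun t ht => by
    simp only [Pi.pow_apply, one_pow]
    linear_combination (unitTangent γ I t 0 ^ 2 + unitTangent γ I t 1 ^ 2)
        * (sin_sq_add_cos_sq (θ t)) + hγ.unitTangent_sq (hJI ht)
      - (unitTangent γ I t 0 * cos (θ t) + unitTangent γ I t 1 * sin (θ t)) * hperp t ht
  have hcθ := continuous_cos.comp_continuousOn hθ.1
  have hsθ := continuous_sin.comp_continuousOn hθ.1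
  rcases hJ.isPreconnected.eq_or_eq_neg_of_sq_eq
    (((hcont 1).mul hcθ).sub ((hcont 0).mul hsθ)) continuousOn_const hsq
    (fun _ => one_ne_zero) with h | h
  · refine ⟨π / 2, fun t ht => ?_⟩
    have h1 : unitTangent γ I t 1 * cos (θ t) - unitTangent γ I t 0 * sin (θ t) = 1 := h ht
    rw [cos_add_pi_div_two, sin_add_pi_div_two]
    constructor
    · linear_combination (-unitTangent γ I t 0) * (sin_sq_add_cos_sq (θ t))
        + cos (θ t) * hperp t ht - sin (θ t) * h1
    · linear_combination (-unitTangent γ I t 1) * (sin_sq_add_cos_sq (θ t))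
        + sin (θ t) * hperp t ht + cos (θ t) * h1
  · refine ⟨-(π / 2), fun t ht => ?_⟩
    have h1 : unitTangent γ I t 1 * cos (θ t) - unitTangent γ I t 0 * sin (θ t) = -1 := h ht
    rw [← sub_eq_add_neg, cos_sub_pi_div_two, sin_sub_pi_div_two]
    constructor
    · linear_combination (-unitTangent γ I t 0) * (sin_sq_add_cos_sq (θ t))
        + cos (θ t) * hperp t ht - sin (θ t) * h1
    · linear_combination (-unitTangent γ I t 1) * (sin_sq_add_cos_sq (θ t))
        + sin (θ t) * hperp t ht + cos (θ t) * h1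

/-- If the unit tangent stays at distance at most `1 / 2` from one of its values, it has a
continuous angle varying by at most `π / 3`. -/
theorem exists_tangent_angle (hγ : IsRegularCurve γ I) (hJI : J ⊆ I) {t₀ : ℝ} (ht₀ : t₀ ∈ I)
    (hclose : ∀ t ∈ J, dist (unitTangent γ I t) (unitTangent γ I t₀) ≤ 1 / 2) :
    ∃ φ : ℝ → ℝ, ContinuousOn φ J ∧ (∀ t ∈ J, unitTangent γ I t 0 = cos (φ t)) ∧
      (∀ t ∈ J, unitTangent γ I t 1 = sin (φ t)) ∧ ∀ s ∈ J, ∀ t ∈ J, |φ s - φ t| ≤ π / 3 := by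
  have hcont : ∀ i, ContinuousOn (fun t => unitTangent γ I t i) J := fun i t ht =>
    (hγ.hasDerivWithinAt_unitTangent (hJI ht) i).continuousWithinAt.mono hJI
  set a := unitTangent γ I t₀ 0 with ha
  set b := unitTangent γ I t₀ 1 with hb
  have hab : a ^ 2 + b ^ 2 = 1 := hγ.unitTangent_sq ht₀
  obtain ⟨φ₀, hφa, hφb⟩ : ∃ φ₀, a = cos φ₀ ∧ b = sin φ₀ := by
    refine ⟨Complex.arg ⟨a, b⟩, ?_, ?_⟩
    · rw [Complex.cos_arg]
      · simp [Complex.norm_def, Complex.normSq_apply, ← sq, hab]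
      · intro h
        have := congrArg Complex.re h
        have := congrArg Complex.im h
        simp_all
    · rw [Complex.sin_arg]
      simp [Complex.norm_def, Complex.normSq_apply, ← sq, hab]
  -- `S t` is the sine of the angle from the tangent at `t₀` to that at `t`. It is bounded by their
  -- distance, so the angle is at most `arcsin (1 / 2) = π / 6` on either side.
  set S : ℝ → ℝ := fun t => a * unitTangent γ I t 1 - b * unitTangent γ I t 0 with hS
  have hbounds : ∀ t ∈ J, |S t| ≤ 1 / 2 ∧
      √(1 - S t ^ 2) = a * unitTangent γ I t 0 + b * unitTangent γ I t 1 := fun t ht => by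
    have h1 := (Plane.dist_le_iff (by norm_num) _ _).1 (hclose t ht)
    rw [← ha, ← hb] at h1
    have h2 := hγ.unitTangent_sq (hJI ht)
    constructor
    · refine abs_le_of_sq_le_sq ?_ (by norm_num)
      simp only [hS]
      nlinarith [sq_nonneg (a * (unitTangent γ I t 0 - a) + b * (unitTangent γ I t 1 - b))]
    · rw [show 1 - S t ^ 2 = (a * unitTangent γ I t 0 + b * unitTangent γ I t 1) ^ 2 by
        simp only [hS]
        linear_combination (-1 : ℝ) * h2
          - (unitTangent γ I t 0 ^ 2 + unitTangent γ I t 1 ^ 2) * hab]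
      exact Real.sqrt_sq (by nlinarith)
  have harc : ∀ t ∈ J, |arcsin (S t)| ≤ π / 6 := fun t ht => by
    have h := abs_le.1 (hbounds t ht).1
    have e : arcsin (1 / 2) = π / 6 := by
      rw [← sin_pi_div_six]
      exact arcsin_sin (by linarith [pi_pos]) (by linarith [pi_pos])
    rw [abs_le, ← e, ← arcsin_neg]
    exact ⟨arcsin_le_arcsin (by linarith), arcsin_le_arcsin h.2⟩
  refine ⟨fun t => φ₀ + arcsin (S t), ?_, fun t ht => ?_, fun t ht => ?_, fun s hs t ht => ?_⟩
  · exact continuousOn_const.add (continuous_arcsin.comp_continuousOn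
      (((hcont 1).const_mul a).sub ((hcont 0).const_mul b)))
  · have h := abs_le.1 (hbounds t ht).1
    rw [cos_add, cos_arcsin, (hbounds t ht).2, sin_arcsin (by linarith) (by linarith), ← hφa,
      ← hφb]
    simp only [hS]
    linear_combination (-unitTangent γ I t 0) * hab
  · have h := abs_le.1 (hbounds t ht).1
    rw [sin_add, cos_arcsin, (hbounds t ht).2, sin_arcsin (by linarith) (by linarith), ← hφa,
      ← hφb]
    simp only [hS]
    linear_combination (-unitTangent γ I t 1) * hab
  · have h1 := abs_le.1 (harc s hs)
    have h2 := abs_le.1 (harc t ht)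
    rw [abs_le]
    constructor <;> linarith

/-! ### Arc length controls parameter length -/

/-- A regular curve is not constant between two distinct parameters. -/
theorem exists_ne (hγ : IsRegularCurve γ I) {s t : ℝ} (hst : s < t) (hI : Icc s t ⊆ I) :
    ∃ u ∈ Ioo s t, ∃ v ∈ Ioo s t, γ u ≠ γ v := by
  by_contra! hcon
  have hm : (s + t) / 2 ∈ Ioo s t := ⟨by linarith, by linarith⟩
  have hmI := hI (Ioo_subset_Icc_self hm)
  have hd := ((hγ.differentiableOn _ hmI).hasDerivWithinAt.mono
    (Ioo_subset_Icc_self.trans hI))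
  have hc := (hasDerivWithinAt_const ((s + t) / 2) (Ioo s t) (γ ((s + t) / 2))).congr
    (f₁ := γ) (fun u hu => hcon u hu _ hm) rfl
  exact hγ.velocity_ne_zero _ hmI ((isOpen_Ioo.uniqueDiffWithinAt hm).eq_deriv _ hd hc)

/-- Pieces of a compact arc whose parameter intervals are not short have length bounded below. -/
theorem exists_lt_eVariationOn (hγ : IsRegularCurve γ I) {a b η : ℝ} (hη : 0 < η)
    (hab : Icc a b ⊆ I) :
    ∃ δ : ℝ, 0 < δ ∧ ∀ s ∈ Icc a b, ∀ t ∈ Icc a b, s + η ≤ t →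
      ENNReal.ofReal δ < eVariationOn γ (Icc s t) := by
  have hK : IsCompact ((Icc a b ×ˢ Icc a b) ∩ {z : ℝ × ℝ | z.1 + η ≤ z.2}) :=
    (isCompact_Icc.prod isCompact_Icc).inter_right
      (isClosed_le (by fun_prop) (by fun_prop))
  suffices h : ∃ δ : ℝ, 0 < δ ∧ ∀ z ∈ (Icc a b ×ˢ Icc a b) ∩ {z : ℝ × ℝ | z.1 + η ≤ z.2},
      ENNReal.ofReal δ < eVariationOn γ (Icc z.1 z.2) by
    obtain ⟨δ, hδ, h⟩ := h
    exact ⟨δ, hδ, fun s hs t ht hst => h (s, t) ⟨⟨hs, ht⟩, hst⟩⟩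
  -- By compactness a local bound suffices.
  refine hK.induction_on (p := fun S => ∃ δ : ℝ, 0 < δ ∧ ∀ z ∈ S,
    ENNReal.ofReal δ < eVariationOn γ (Icc z.1 z.2)) ⟨1, one_pos, by simp⟩ ?_ ?_ ?_
  · rintro S S' hSS ⟨δ, hδ, h⟩
    exact ⟨δ, hδ, fun z hz => h z (hSS hz)⟩
  · rintro S S' ⟨δ, hδ, h⟩ ⟨δ', hδ', h'⟩
    refine ⟨min δ δ', lt_min hδ hδ', fun z hz => ?_⟩
    rcases hz with hz | hz
    · exact (ENNReal.ofReal_le_ofReal (min_le_left _ _)).trans_lt (h z hz)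
    · exact (ENNReal.ofReal_le_ofReal (min_le_right _ _)).trans_lt (h' z hz)
  · rintro ⟨s, t⟩ ⟨⟨hs, ht⟩, hst⟩
    simp only [mem_ofPred_eq] at hst hs ht
    obtain ⟨u, hu, v, hv, huv⟩ := hγ.exists_ne (s := s) (t := t) (by linarith)
      ((Icc_subset_Icc hs.1 ht.2).trans hab)
    -- As `u` and `v` are interior, all nearby intervals still contain them, so their variation is
    -- at least `dist (γ u) (γ v)`; halving makes the bound strict.
    refine ⟨{z : ℝ × ℝ | z.1 < min u v ∧ max u v < z.2}, mem_nhdsWithin_of_mem_nhds ?_,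
      dist (γ u) (γ v) / 2, half_pos (dist_pos.2 huv), fun z hz => ?_⟩
    · refine IsOpen.mem_nhds ?_ ⟨lt_min hu.1 hv.1, max_lt hu.2 hv.2⟩
      exact (isOpen_lt continuous_fst continuous_const).inter
        (isOpen_lt continuous_const continuous_snd)
    · obtain ⟨h1, h2⟩ := hz
      rw [lt_min_iff] at h1
      rw [max_lt_iff] at h2
      refine lt_of_lt_of_le ?_ (eVariationOn.edist_le γ (x := u) (y := v) ⟨h1.1.le, h2.1.le⟩
        ⟨h1.2.le, h2.2.le⟩)
      rw [edist_dist, ENNReal.ofReal_lt_ofReal_iff (dist_pos.2 huv)]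
      exact half_lt_self (dist_pos.2 huv)

end IsRegularCurve

/-! ### The embedding theorem -/

theorem theorem4p10 (r : ℝ) (hr : 0 < r) (γ : ℝ → Plane) (I : Set ℝ)
    (hγ : IsRegularCurve γ I)
    (hcurv : ∀ t ∈ I, radiusOfCurvature γ I t ≤ ENNReal.ofReal r) :
    -- sufficiently short pieces
    (∀ a b : ℝ, Icc a b ⊆ I →
      ∃ δ : ℝ, 0 < δ ∧ ∀ J : Set ℝ, J.OrdConnected → J ⊆ Icc a b →
        eVariationOn γ J ≤ ENNReal.ofReal δ → EmbedsInRMaximalBoundary r γ J) ∧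
    -- pieces along which the normal turns by at most `π / 3`
    (∀ (J : Set ℝ) (θ : ℝ → ℝ), J.OrdConnected → J ⊆ I → IsNormalAngle γ I J θ →
      (∀ s ∈ J, ∀ t ∈ J, |θ s - θ t| ≤ Real.pi / 3) →
        EmbedsInRMaximalBoundary r γ J) := by
  refine ⟨fun a b hab => ?_, fun J θ hJ hJI hθ hturn => ?_⟩
  · have hunif := isCompact_Icc.uniformContinuousOn_of_continuous
      (hγ.differentiableOn_unitTangent.continuousOn.mono hab)
    -- The tolerance `1 / 2` is the one required by `exists_tangent_angle`.
    obtain ⟨η, hη, hclose⟩ := Metric.uniformContinuousOn_iff_le.1 hunif (1 / 2) (by norm_num)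
    obtain ⟨δ, hδ, hlen⟩ := hγ.exists_lt_eVariationOn hη hab
    refine ⟨δ, hδ, fun J hJ hJab hvar => ?_⟩
    have hJI := hJab.trans hab
    have hshort : ∀ s ∈ J, ∀ t ∈ J, t - s ≤ η := fun s hs t ht => by
      by_contra! hlt
      exact absurd ((hlen s (hJab hs) t (hJab ht) (by linarith)).trans_le
        ((eVariationOn.mono γ (hJ.out hs ht)).trans hvar)) (lt_irrefl _)
    obtain ⟨φ, hφ, h0, h1, hturn⟩ : ∃ φ : ℝ → ℝ, ContinuousOn φ J ∧
        (∀ t ∈ J, unitTangent γ I t 0 = cos (φ t)) ∧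
        (∀ t ∈ J, unitTangent γ I t 1 = sin (φ t)) ∧
        ∀ s ∈ J, ∀ t ∈ J, |φ s - φ t| ≤ π / 3 := by
      rcases J.eq_empty_or_nonempty with rfl | ⟨t₀, ht₀⟩
      · exact ⟨0, by simp⟩
      · refine hγ.exists_tangent_angle hJI (hJI ht₀) fun t ht =>
          hclose t (hJab ht) t₀ (hJab ht₀) ?_
        rw [Real.dist_eq, abs_le]
        constructor <;> linarith [hshort t ht t₀ ht₀, hshort t₀ ht₀ t ht]
    exact hγ.embedsInRMaximalBoundary hr hcurv hJ hJI hφ h0 h1 hturn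
  · obtain ⟨c, hc⟩ := hγ.tangent_angle_of_normal_angle hJ hJI hθ
    refine hγ.embedsInRMaximalBoundary hr hcurv hJ hJI (φ := fun t => θ t + c)
      (hθ.1.add continuousOn_const) (fun t ht => (hc t ht).1) (fun t ht => (hc t ht).2)
      fun s hs t ht => ?_
    rw [add_sub_add_right_eq_sub]
    exact hturn s hs t ht
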